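/- For a subset $A$ of a real vector space let $\mathrm{PLC}(A)$ denote the set of all finite sums $\sum_{a\in A}\lambda_a a$ with all $\lambda_a\ge 0$ and at least one $\lambda_a>0$. Let $V$ be a real vector space (of arbitrary dimension) with a symmetric bilinear form $(\cdot,\cdot)$, and let $\Delta\subseteq V$ be a root basis; that is, $(a,a)=1$ for all $a\in\Delta$; for all distinct $a,b\in\Delta$ either $(a,b)=-\cos(\pi/m_{ab})$ for some integer $m_{ab}=m_{ba}\ge 2$, or $(a,b)\le -1$ (and then $m_{ab}=\infty$); and $0\notin \mathrm{PLC}(\Delta)$. (Linear independence of $\Delta$ is not assumed.) Let $W$ be the associated Coxeter group, generated by involutions $r_a$ ($a\in\Delta$) subject only to the relations $(r_ar_b)^{m_{ab}}=1$ for distinct $a,b$ with $m_{ab}\ne\infty$, acting linearly on $V$ by $r_a x=x-2(x,a)a$. Put $\Phi=\{wa\mid w\in W,\ a\in\Delta\}$, $\Phi^+=\Phi\cap\mathrm{PLC}(\Delta)$ and $P=\mathrm{PLC}(\Delta)\cup\{0\}$. Let $P^*=\{f\in V^*\mid f(v)\ge 0\text{ for all }v\in P\}$, where $V^*=\mathrm{Hom}(V,\mathbb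 R)$ and $W$ acts on $V^*$ by $(wf)(v)=f(w^{-1}v)$; let $U=\bigcup_{w\in W}wP^*$ be the Tits cone and $U^*=\{v\in V\mid f(v)\ge 0\text{ for all }f\in U\}$. The imaginary cone of $W$ is $$Q=\{v\in U^*\mid (v,a)\le 0\text{ for all but finitely many }a\in\Phi^+\}.$$ If $\Delta$ is finite, then $$Q=\{\,wv\mid w\in W\text{ and }v\in P\text{ such that }(v,a)\le 0\text{ for all }a\in\Phi^+\,\}.$$ -/

import Mathlib

/-- The positive linear cone of a set `A`: all finite sums `∑ λ_a a` over elements `a` of `A`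
with all `λ_a ≥ 0` and at least one `λ_a > 0`. -/
def PLC {V : Type*} [AddCommGroup V] [Module ℝ V] (A : Set V) : Set V :=
  {v | ∃ c : A →₀ ℝ, (∀ a, 0 ≤ c a) ∧ (∃ a, 0 < c a) ∧ v = c.sum fun a r => r • (a : V)}

/-- A Coxeter datum `(V, Δ, (·,·))`: a symmetric bilinear form on the real vector space `V`
together with a root basis `Δ`. The root basis may be infinite or linearly dependent. -/
structure CoxeterDatum (V : Type*) [AddCommGroup V] [Module ℝ V] where
  form : LinearMap.BilinForm ℝ V
  form_symm : ∀ x y, form x y = form y x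
  Δ : Set V
  form_self : ∀ a ∈ Δ, form a a = 1
  form_ne : ∀ a ∈ Δ, ∀ b ∈ Δ, a ≠ b →
    (∃ m : ℕ, 2 ≤ m ∧ form a b = -Real.cos (Real.pi / m)) ∨ form a b ≤ -1
  zero_notMem : (0 : V) ∉ PLC Δ

namespace CoxeterDatum

variable {V : Type*} [AddCommGroup V] [Module ℝ V] (D : CoxeterDatum V)

/-- The number `m_{ab}`. For `a ≠ b` the set below has at most one element; when it is empty,
i.e. `(a, b) ≤ -1`, its infimum is `0`, which is Mathlib's encoding of `m_{ab} = ∞` in a Coxeter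
matrix. -/
noncomputable def m (a b : D.Δ) : ℕ :=
  open Classical in
  if a = b then 1 else sInf {n : ℕ | 2 ≤ n ∧ D.form a b = -Real.cos (Real.pi / n)}

theorem m_symm (a b : D.Δ) : D.m a b = D.m b a := by
  unfold m
  rw [D.form_symm a b]
  split_ifs with h h' h' <;> first | rfl | exact absurd h.symm h' | exact absurd h'.symm h

theorem m_self (a : D.Δ) : D.m a a = 1 := by simp [m]

theorem m_spec {a b : D.Δ} (hab : a ≠ b) (h : D.m a b ≠ 0) :
    2 ≤ D.m a b ∧ D.form a b = -Real.cos (Real.pi / D.m a b) := by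
  have hm : D.m a b = sInf {n : ℕ | 2 ≤ n ∧ D.form a b = -Real.cos (Real.pi / n)} := by
    simp [m, hab]
  have hne : {n : ℕ | 2 ≤ n ∧ D.form a b = -Real.cos (Real.pi / n)}.Nonempty := by
    by_contra hc
    rw [Set.not_nonempty_iff_eq_empty] at hc
    rw [hc, Nat.sInf_empty] at hm
    exact h hm
  have := Nat.sInf_mem hne
  rwa [← hm] at this

theorem m_eq {a b : D.Δ} (hab : a ≠ b) {n : ℕ} (hn : 2 ≤ n)
    (h : D.form a b = -Real.cos (Real.pi / n)) : D.m a b = n := by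
  have hsub : ∀ k : ℕ, 2 ≤ k → D.form a b = -Real.cos (Real.pi / k) → k = n := by
    intro k hk hk'
    have hmem : ∀ j : ℕ, 2 ≤ j → Real.pi / j ∈ Set.Icc 0 Real.pi := fun j hj =>
      ⟨by have := Real.pi_pos; positivity,
        div_le_self Real.pi_pos.le (by exact_mod_cast (by omega : 1 ≤ j))⟩
    have hcos : Real.cos (Real.pi / k) = Real.cos (Real.pi / n) := by linarith
    have hdiv := Real.injOn_cos (hmem k hk) (hmem n hn) hcos
    have hk0 : (k : ℝ) ≠ 0 := by exact_mod_cast (by omega : k ≠ 0)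
    have hn0 : (n : ℝ) ≠ 0 := by exact_mod_cast (by omega : n ≠ 0)
    have hpi := Real.pi_ne_zero
    field_simp at hdiv
    exact_mod_cast hdiv.symm
  have hset : {k : ℕ | 2 ≤ k ∧ D.form a b = -Real.cos (Real.pi / k)} = {n} :=
    Set.eq_singleton_iff_unique_mem.2 ⟨⟨hn, h⟩, fun k hk => hsub k hk.1 hk.2⟩
  simp [m, hab, hset]

theorem m_eq_zero {a b : D.Δ} (hab : a ≠ b) (h : D.form a b ≤ -1) : D.m a b = 0 := by
  by_contra h0
  obtain ⟨h2, hf⟩ := D.m_spec hab h0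
  have h2' : (2 : ℝ) ≤ D.m a b := by exact_mod_cast h2
  have hp := Real.pi_pos
  have hle : Real.pi / D.m a b ≤ Real.pi := div_le_self hp.le (by linarith)
  have := Real.cos_lt_cos_of_nonneg_of_le_pi le_rfl hle (by positivity)
  rw [Real.cos_zero] at this
  linarith

/-- The Coxeter matrix `(m_{ab})` of the datum. -/
noncomputable def coxeterMatrix : CoxeterMatrix D.Δ where
  M := Matrix.of fun a b => D.m a b
  isSymm := by
    ext a b
    exact D.m_symm b a
  diagonal a := D.m_self a
  off_diagonal a b hab := by
    intro h
    have h1 : D.m a b = 1 := h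
    have := (D.m_spec hab (by rw [h1]; exact one_ne_zero)).1
    omega

/-- The abstract Coxeter group `W` of the datum: generated by the involutions `r_a`, `a ∈ Δ`,
subject only to `(r_a r_b)^{m_{ab}} = 1` for `m_{ab} ≠ ∞`. -/
abbrev W : Type _ := D.coxeterMatrix.Group

/-- The reflection `ρ_a x = x - 2 (x, a) a` in an element `a` of `Δ`. -/
noncomputable def reflection (a : D.Δ) : V ≃ₗ[ℝ] V :=
  Module.reflection (x := (a : V)) (f := (2 : ℝ) • D.form.flip a)
    (by simp [D.form_self a a.2])

theorem reflection_apply (a : D.Δ) (x : V) :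
    D.reflection a x = x - (2 * D.form x a) • (a : V) := by
  simp [reflection, Module.reflection_apply]

open Polynomial.Chebyshev in
/-- The reflections `ρ_a` satisfy the defining relations of `W`. -/
theorem reflection_isLiftable : D.coxeterMatrix.IsLiftable D.reflection := by
  intro a b
  change (D.reflection a * D.reflection b) ^ D.m a b = 1
  rcases eq_or_ne a b with rfl | hab
  · rw [m_self, pow_one]
    ext x
    simp only [LinearEquiv.mul_apply, LinearEquiv.coe_one, id]
    exact Module.involutive_reflection _ x
  rcases eq_or_ne (D.m a b) 0 with h0 | h0
  · rw [h0, pow_zero]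
  obtain ⟨h2, hform⟩ := D.m_spec hab h0
  set n := D.m a b with hn
  clear_value n
  set θ : ℝ := Real.pi / n with hθ
  have hn0 : (n : ℝ) ≠ 0 := by exact_mod_cast h0
  have hnθ : n * θ = Real.pi := by rw [hθ]; field_simp
  have hba : D.form b a = -Real.cos θ := by rw [D.form_symm, hform]
  have ht : ((2 : ℝ) • D.form.flip (a : V)) (b : V) * ((2 : ℝ) • D.form.flip (b : V)) (a : V) - 2
      = 2 * Real.cos (2 * θ) := by
    simp only [LinearMap.smul_apply, LinearMap.BilinForm.flip_apply, smul_eq_mul, hform, hba, Real.cos_two_mul]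
    ring
  have hS := S_two_mul_real_cos (2 * θ)
  ext z
  unfold reflection
  rw [Module.reflection_mul_reflection_pow_apply _ _ n z (2 * Real.cos (2 * θ)) ht.symm]
  rcases eq_or_lt_of_le h2 with h2 | h3
  · have hθ2 : θ = Real.pi / 2 := by rw [hθ, ← h2]; norm_num
    subst h2
    have e : Real.cos (2 * θ) = -1 := by
      rw [hθ2, mul_div_cancel₀ _ (two_ne_zero)]; exact Real.cos_pi
    have e1 : D.form a b = 0 := by rw [hform, hθ2]; simp
    have e2 : D.form b a = 0 := by rw [hba, hθ2]; simp
    simp only [LinearMap.smul_apply, LinearMap.BilinForm.flip_apply, smul_eq_mul, e, e1, e2]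
    norm_num
    module
  · have hs : Real.sin (2 * θ) ≠ 0 := by
      refine (Real.sin_pos_of_pos_of_lt_pi ?_ ?_).ne'
      · have := Real.pi_pos
        positivity
      · have h3' : (3 : ℝ) ≤ n := by exact_mod_cast h3
        have hp := Real.pi_pos
        have hθ0 : 0 < θ := by rw [hθ]; positivity
        have : 3 * θ ≤ n * θ := mul_le_mul_of_nonneg_right h3' hθ0.le
        rw [hnθ] at this
        linarith
    rcases Nat.even_or_odd' n with ⟨k, hk | hk⟩
    · have i1 : ((n : ℤ) - 2) / 2 = k - 1 := by omega
      have i2 : ((n : ℤ) - 1) / 2 = k - 1 := by omega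
      have z1 : (S ℝ ((k : ℤ) - 1)).eval (2 * Real.cos (2 * θ)) = 0 := by
        have := hS ((k : ℤ) - 1)
        have e : (((k : ℤ) - 1 : ℤ) + 1 : ℝ) * (2 * θ) = Real.pi := by
          rw [← hnθ, hk]; push_cast; ring
        rw [e, Real.sin_pi] at this
        exact (mul_eq_zero.1 this).resolve_right hs
      rw [i1, i2, z1]
      simp
    · have i1 : ((n : ℤ) - 2) / 2 = k - 1 := by omega
      have i2 : ((n : ℤ) - 1) / 2 = k := by omega
      have i3 : ((n : ℤ) - 3) / 2 = k - 1 := by omega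
      have i4 : (n : ℤ) / 2 = k := by omega
      have z1 : (S ℝ (k : ℤ)).eval (2 * Real.cos (2 * θ)) +
          (S ℝ ((k : ℤ) - 1)).eval (2 * Real.cos (2 * θ)) = 0 := by
        have q1 := hS (k : ℤ)
        have q2 := hS ((k : ℤ) - 1)
        have e1 : (((k : ℤ) : ℝ) + 1) * (2 * θ) = Real.pi + θ := by
          rw [← hnθ, hk]; push_cast; ring
        have e2 : (((k : ℤ) - 1 : ℤ) + 1 : ℝ) * (2 * θ) = Real.pi - θ := by
          rw [← hnθ, hk]; push_cast; ring
        rw [e1, add_comm, Real.sin_add_pi] at q1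
        rw [e2, Real.sin_pi_sub] at q2
        have : ((S ℝ (k : ℤ)).eval (2 * Real.cos (2 * θ)) +
          (S ℝ ((k : ℤ) - 1)).eval (2 * Real.cos (2 * θ))) * Real.sin (2 * θ) = 0 := by
          rw [add_mul, q1, q2]; ring
        exact (mul_eq_zero.1 this).resolve_right hs
      rw [i1, i2, i3, i4, z1]
      simp

/-- The homomorphism `φ : W → GL(V)` with `φ(r_a) = ρ_a`; it gives the action `w v = φ(w) v`
of `W` on `V`. -/
noncomputable def φ : D.W →* (V ≃ₗ[ℝ] V) :=
  D.coxeterMatrix.toCoxeterSystem.lift ⟨D.reflection, D.reflection_isLiftable⟩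

theorem φ_simple (a : D.Δ) : D.φ (D.coxeterMatrix.simple a) = D.reflection a :=
  D.coxeterMatrix.toCoxeterSystem.lift_apply_simple D.reflection_isLiftable a

/-- The root system `Φ = {w a | w ∈ W, a ∈ Δ}`. -/
def roots : Set V := {x | ∃ (w : D.W) (a : D.Δ), x = D.φ w a}

/-- The positive roots `Φ⁺ = Φ ∩ PLC(Δ)`. -/
def posRoots : Set V := D.roots ∩ PLC D.Δ

/-- The cone `P = PLC(Δ) ∪ {0}`. -/
def P : Set V := PLC D.Δ ∪ {0}

/-- The dual cone `P* = {f ∈ V* | f(v) ≥ 0 for all v ∈ P}`. -/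
def dualP : Set (Module.Dual ℝ V) := {f | ∀ v ∈ D.P, 0 ≤ f v}

/-- The contragredient action `(w f)(v) = f(w⁻¹ v)` of `W` on `V*`. -/
noncomputable def dualAct (w : D.W) (f : Module.Dual ℝ V) : Module.Dual ℝ V :=
  f ∘ₗ (D.φ w⁻¹ : V →ₗ[ℝ] V)

/-- The Tits cone `U = ⋃_{w ∈ W} w P*`. -/
def titsCone : Set (Module.Dual ℝ V) := ⋃ w : D.W, D.dualAct w '' D.dualP

/-- The dual `U* = {v ∈ V | f(v) ≥ 0 for all f ∈ U}` of the Tits cone. -/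
def dualTitsCone : Set V := {v | ∀ f ∈ D.titsCone, 0 ≤ f v}

/-- The imaginary cone `Q`: the `v ∈ U*` such that `(v, a) ≤ 0` for all but finitely many
positive roots `a`. -/
def imaginaryCone : Set V :=
  {v | v ∈ D.dualTitsCone ∧ {a ∈ D.posRoots | ¬ D.form v a ≤ 0}.Finite}

end CoxeterDatum

theorem nonneg_of_mem_hull {V : Type*} [AddCommGroup V] [Module ℝ V] {A : Set V}
    (f : Module.Dual ℝ V) (hf : ∀ a ∈ A, 0 ≤ f a) {x : V} (hx : x ∈ PointedCone.hull ℝ A) :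
    0 ≤ f x := by
  induction hx using Submodule.span_induction with
  | mem x h => exact hf x h
  | zero => simp
  | add x y _ _ h1 h2 => rw [map_add]; exact add_nonneg h1 h2
  | smul c x _ h =>
    change 0 ≤ f ((c : ℝ) • x)
    rw [map_smul]
    exact mul_nonneg c.2 h

/-- **Farkas' lemma** for finitely generated cones in an arbitrary real vector space: a vector
outside the cone is separated from it by a linear functional. -/
theorem exists_dual_neg_of_notMem_hull {ι V : Type*} [AddCommGroup V] [Module ℝ V]
    (s : Finset ι) (g : ι → V) (v : V) (hv : v ∉ PointedCone.hull ℝ (g '' s)) :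
    ∃ f : Module.Dual ℝ V, (∀ i ∈ s, 0 ≤ f (g i)) ∧ f v < 0 := by
  classical
  induction s using Finset.induction_on generalizing g v with
  | empty =>
    have hv0 : v ≠ 0 := by
      rintro rfl
      exact hv (zero_mem _)
    obtain ⟨f, hf⟩ : ∃ f : Module.Dual ℝ V, f v ≠ 0 := by
      by_contra! h
      exact hv0 ((Module.forall_dual_apply_eq_zero_iff ℝ v).1 h)
    rcases lt_or_gt_of_ne hf with h | h
    · exact ⟨f, by simp, h⟩
    · exact ⟨-f, by simp, by simpa using h⟩
  | insert a s _ ih =>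
    have hle : PointedCone.hull ℝ (g '' s) ≤ PointedCone.hull ℝ (g '' ↑(insert a s)) :=
      Submodule.span_mono (Set.image_mono (by simp))
    obtain ⟨f, hf, hfv⟩ := ih g v fun h => hv (hle h)
    rcases le_or_gt 0 (f (g a)) with ha | ha
    · exact ⟨f, by simpa using ⟨ha, hf⟩, hfv⟩
    let p : V →ₗ[ℝ] V := LinearMap.id - (f.smulRight ((f (g a))⁻¹ • g a))
    have hp : ∀ x, p x = x - (f x / f (g a)) • g a := fun x => by
      simp [p, smul_smul, div_eq_mul_inv]
    have hmem : p v ∉ PointedCone.hull ℝ ((fun i => p (g i)) '' s) := by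
      intro h
      rw [show (fun i => p (g i)) '' (s : Set ι) = p '' (g '' s) by rw [Set.image_image]] at h
      have h' : p v ∈ PointedCone.map p (PointedCone.hull ℝ (g '' s)) := by
        rwa [PointedCone.map, PointedCone.hull, Submodule.map_span]
      obtain ⟨x, hx, hxv⟩ := PointedCone.mem_map.1 h'
      have hfx : 0 ≤ f x := nonneg_of_mem_hull f (by rintro _ ⟨i, hi, rfl⟩; exact hf i hi) hx
      apply hv
      have : v = x + ((f v / f (g a)) - (f x / f (g a))) • g a := by
        rw [hp, hp] at hxv
        rw [sub_smul, ← add_sub_assoc, add_sub_right_comm, hxv, sub_add_cancel]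
      rw [this]
      refine add_mem (hle hx) (PointedCone.smul_mem _ ?_ (PointedCone.subset_hull ⟨a, by simp, rfl⟩))
      rw [← sub_div]
      exact div_nonneg_of_nonpos (by linarith) ha.le
    obtain ⟨k, hk, hkv⟩ := ih _ _ hmem
    refine ⟨k ∘ₗ p, ?_, hkv⟩
    intro i hi
    rcases Finset.mem_insert.1 hi with rfl | hi
    · simp [hp, div_self ha.ne]
    · exact hk i hi

namespace CoxeterDatum

variable {V : Type*} [AddCommGroup V] [Module ℝ V] (D : CoxeterDatum V)

/-- The convex cone spanned by the root basis. -/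
noncomputable def cone : PointedCone ℝ V := PointedCone.hull ℝ D.Δ

theorem simpleRoot_mem_cone (a : D.Δ) : (a : V) ∈ D.cone := PointedCone.subset_hull a.2

theorem finsuppSum_mem_hull {A : Set V} (c : A →₀ ℝ) (hc : ∀ a, 0 ≤ c a) :
    (c.sum fun a r => r • (a : V)) ∈ PointedCone.hull ℝ A :=
  sum_mem fun a _ => PointedCone.smul_mem _ (hc a) (PointedCone.subset_hull a.2)

theorem mem_hull_iff_finsupp {A : Set V} {v : V} : v ∈ PointedCone.hull ℝ A ↔
    ∃ c : A →₀ ℝ, (∀ a, 0 ≤ c a) ∧ v = c.sum fun a r => r • (a : V) := by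
  constructor
  · intro h
    induction h using Submodule.span_induction with
    | mem x h =>
      refine ⟨Finsupp.single ⟨x, h⟩ 1, fun a => ?_, by simp⟩
      classical
      rw [Finsupp.single_apply]
      split_ifs <;> norm_num
    | zero => exact ⟨0, by simp, by simp⟩
    | add x y _ _ h1 h2 =>
      obtain ⟨c, hc, rfl⟩ := h1
      obtain ⟨d, hd, rfl⟩ := h2
      refine ⟨c + d, fun a => add_nonneg (hc a) (hd a), ?_⟩
      rw [Finsupp.sum_add_index'] <;> simp [add_smul]
    | smul r x _ h =>
      obtain ⟨c, hc, rfl⟩ := h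
      refine ⟨(r : ℝ) • c, fun a => mul_nonneg r.2 (hc a), ?_⟩
      rw [Finsupp.sum_smul_index (by simp), Finsupp.smul_sum]
      simp only [mul_smul]
      rfl
  · rintro ⟨c, hc, rfl⟩
    exact finsuppSum_mem_hull c hc

theorem mem_PLC_iff {v : V} : v ∈ PLC D.Δ ↔ v ∈ D.cone ∧ v ≠ 0 := by
  constructor
  · intro h
    refine ⟨?_, fun h0 => D.zero_notMem (h0 ▸ h)⟩
    obtain ⟨c, hc, _, rfl⟩ := h
    exact finsuppSum_mem_hull c hc
  · rintro ⟨h, h0⟩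
    obtain ⟨c, hc, rfl⟩ := mem_hull_iff_finsupp.1 h
    refine ⟨c, hc, ?_, rfl⟩
    by_contra! hneg
    apply h0
    have : c = 0 := Finsupp.ext fun a => le_antisymm (hneg a) (hc a)
    simp [this]

theorem mem_P_iff {v : V} : v ∈ D.P ↔ v ∈ D.cone := by
  rw [P, Set.mem_union, mem_PLC_iff, Set.mem_singleton_iff]
  refine ⟨?_, fun h => ?_⟩
  · rintro (h | rfl)
    · exact h.1
    · exact zero_mem _
  · by_cases h0 : v = 0
    · exact Or.inr h0
    · exact Or.inl ⟨h, h0⟩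

theorem add_mem_PLC {A : Set V} {x y : V} (hx : x ∈ PLC A)
    (hy : y ∈ PointedCone.hull ℝ A) : x + y ∈ PLC A := by
  obtain ⟨c, hc, ⟨a, ha⟩, rfl⟩ := hx
  obtain ⟨d, hd, rfl⟩ := mem_hull_iff_finsupp.1 hy
  refine ⟨c + d, fun a => add_nonneg (hc a) (hd a), ⟨a, add_pos_of_pos_of_nonneg ha (hd a)⟩, ?_⟩
  rw [Finsupp.sum_add_index'] <;> simp [add_smul]

theorem eq_zero_of_add_eq_zero_of_mem_cone {x y : V} (hx : x ∈ D.cone) (hy : y ∈ D.cone)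
    (h : x + y = 0) : x = 0 := by
  by_contra h0
  exact D.zero_notMem (h ▸ add_mem_PLC (D.mem_PLC_iff.2 ⟨hx, h0⟩) hy)


theorem form_reflection (a : D.Δ) (x y : V) :
    D.form (D.reflection a x) (D.reflection a y) = D.form x y := by
  simp only [reflection_apply, map_sub, map_smul, LinearMap.sub_apply, LinearMap.smul_apply,
    smul_eq_mul, D.form_self a a.2, D.form_symm a y]
  ring

/-- The Coxeter system of the datum. -/
noncomputable abbrev cs : CoxeterSystem D.coxeterMatrix D.W := D.coxeterMatrix.toCoxeterSystem

theorem φ_cs_simple (a : D.Δ) (x : V) : D.φ (D.cs.simple a) x = x - (2 * D.form x a) • (a : V) := by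
  rw [← D.reflection_apply, ← D.φ_simple]
  rfl

theorem φ_mul (w w' : D.W) (x : V) : D.φ (w * w') x = D.φ w (D.φ w' x) := by
  rw [map_mul, LinearEquiv.mul_apply]

theorem φ_inv_apply (w : D.W) (x : V) : D.φ w⁻¹ (D.φ w x) = x := by
  rw [← φ_mul, inv_mul_cancel, map_one, LinearEquiv.coe_one, id]

theorem φ_apply_inv (w : D.W) (x : V) : D.φ w (D.φ w⁻¹ x) = x := by
  rw [← φ_mul, mul_inv_cancel, map_one, LinearEquiv.coe_one, id]

theorem φ_simple_simple (a : D.Δ) (x : V) :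
    D.φ (D.cs.simple a) (D.φ (D.cs.simple a) x) = x := by
  rw [← φ_mul, CoxeterSystem.simple_mul_simple_self, map_one, LinearEquiv.coe_one, id]

theorem φ_simple_self (a : D.Δ) : D.φ (D.cs.simple a) (a : V) = -(a : V) := by
  rw [φ_cs_simple, D.form_self a a.2]
  module

theorem form_φ_simple (a : D.Δ) (x y : V) :
    D.form (D.φ (D.cs.simple a) x) (D.φ (D.cs.simple a) y) = D.form x y := by
  rw [φ_cs_simple, φ_cs_simple, ← reflection_apply, ← reflection_apply, form_reflection]

theorem form_φ (w : D.W) (x y : V) : D.form (D.φ w x) (D.φ w y) = D.form x y := by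
  induction w using D.cs.simple_induction_left with
  | one => simp
  | mul_simple_left w i ih => rw [φ_mul, φ_mul, form_φ_simple, ih]

theorem form_φ_left (w : D.W) (x y : V) : D.form (D.φ w x) y = D.form x (D.φ w⁻¹ y) := by
  rw [← D.form_φ w x, φ_apply_inv]

/-- The Chebyshev-type recursion `p₀ = 0`, `p₁ = 1`, `pₙ₊₂ = 2 c pₙ₊₁ - pₙ` that gives the
coefficients of the roots of a dihedral group. -/
noncomputable def dihedralCoeff (c : ℝ) : ℕ → ℝ
  | 0 => 0
  | 1 => 1
  | n + 2 => 2 * c * dihedralCoeff c (n + 1) - dihedralCoeff c n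

theorem dihedralCoeff_nonneg_of_one_le {c : ℝ} (hc : 1 ≤ c) (n : ℕ) : 0 ≤ dihedralCoeff c n := by
  have key : ∀ n, 0 ≤ dihedralCoeff c n ∧ dihedralCoeff c n ≤ dihedralCoeff c (n + 1) := by
    intro n
    induction n with
    | zero => simp [dihedralCoeff]
    | succ n ih =>
      refine ⟨ih.1.trans ih.2, ?_⟩
      rw [dihedralCoeff]
      nlinarith [mul_nonneg (sub_nonneg.2 hc) (ih.1.trans ih.2)]
  exact (key n).1

theorem sin_mul_dihedralCoeff (θ : ℝ) (n : ℕ) :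
    Real.sin θ * dihedralCoeff (Real.cos θ) n = Real.sin (n * θ) := by
  have key : ∀ n : ℕ, Real.sin θ * dihedralCoeff (Real.cos θ) n = Real.sin (n * θ) ∧
      Real.sin θ * dihedralCoeff (Real.cos θ) (n + 1) = Real.sin ((n + 1 : ℕ) * θ) := by
    intro n
    induction n with
    | zero => simp [dihedralCoeff]
    | succ n ih =>
      refine ⟨ih.2, ?_⟩
      rw [dihedralCoeff, mul_sub, ih.1, mul_left_comm, ih.2]
      have e1 : ((n + 1 + 1 : ℕ) : ℝ) * θ = (n + 1 : ℕ) * θ + θ := by push_cast; ring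
      have e2 : (n : ℝ) * θ = (n + 1 : ℕ) * θ - θ := by push_cast; ring
      rw [e1, e2, Real.sin_add, Real.sin_sub]
      ring
  exact (key n).1

theorem dihedralCoeff_nonneg_of_le {m n : ℕ} (hm : 2 ≤ m) (hn : n ≤ m) :
    0 ≤ dihedralCoeff (Real.cos (Real.pi / m)) n := by
  have hm' : (2 : ℝ) ≤ m := by exact_mod_cast hm
  have hn' : (n : ℝ) ≤ m := by exact_mod_cast hn
  have hpi := Real.pi_pos
  have hs : 0 < Real.sin (Real.pi / m) :=
    Real.sin_pos_of_pos_of_lt_pi (by positivity) (div_lt_self hpi (by linarith))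
  refine nonneg_of_mul_nonneg_right ?_ hs
  rw [sin_mul_dihedralCoeff]
  refine Real.sin_nonneg_of_nonneg_of_le_pi (by positivity) ?_
  rw [mul_div_assoc', div_le_iff₀ (by linarith), mul_comm]
  exact mul_le_mul_of_nonneg_left hn' hpi.le

theorem dihedralCoeff_nonneg {a b : D.Δ} (hab : a ≠ b) {n : ℕ}
    (hn : D.m a b ≠ 0 → n ≤ D.m a b) : 0 ≤ dihedralCoeff (-D.form a b) n := by
  have hab' : (a : V) ≠ b := fun h => hab (Subtype.ext h)
  rcases D.form_ne a a.2 b b.2 hab' with ⟨m, hm, h⟩ | h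
  · have := D.m_eq hab hm h
    rw [h, neg_neg]
    exact dihedralCoeff_nonneg_of_le hm (this ▸ hn (by omega))
  · exact dihedralCoeff_nonneg_of_one_le (by linarith) n

open CoxeterSystem

theorem φ_alternatingWord_apply (a b : D.Δ) (k : ℕ) :
    D.φ (D.cs.wordProd (alternatingWord a b k)) (a : V) =
      dihedralCoeff (-D.form a b) (k + 1) • ((if Even k then a else b : D.Δ) : V) +
        dihedralCoeff (-D.form a b) k • ((if Even k then b else a : D.Δ) : V) := by
  induction k with
  | zero => simp [alternatingWord, dihedralCoeff]
  | succ k ih =>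
    rw [alternatingWord_succ', CoxeterSystem.wordProd_cons, φ_mul, ih, φ_cs_simple, dihedralCoeff]
    by_cases h : Even k
    · simp only [h, if_true, Nat.even_add_one, not_true, if_false, map_add, map_smul,
        LinearMap.add_apply, LinearMap.smul_apply, smul_eq_mul, D.form_self b b.2]
      module
    · simp only [h, if_true, Nat.even_add_one, not_false_iff, if_false, map_add, map_smul,
        LinearMap.add_apply, LinearMap.smul_apply, smul_eq_mul, D.form_self a a.2,
        D.form_symm b a]
      module

theorem exists_wordProd_alternatingWord_add (a b : D.Δ) (j k : ℕ) :
    ∃ q : D.W, D.cs.length q ≤ j ∧ D.cs.wordProd (alternatingWord a b (k + j)) =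
      q * D.cs.wordProd (alternatingWord a b k) := by
  induction j with
  | zero => exact ⟨1, by simp, by simp⟩
  | succ j ih =>
    obtain ⟨q, hq, e⟩ := ih
    refine ⟨D.cs.simple (if Even (k + j) then b else a) * q, ?_, ?_⟩
    · have := D.cs.length_mul_le (D.cs.simple (if Even (k + j) then b else a)) q
      rw [D.cs.length_simple] at this
      omega
    · rw [← add_assoc, alternatingWord_succ', CoxeterSystem.wordProd_cons, e, mul_assoc]

theorem length_alternatingWord_mul_simple_lt (a b : D.Δ) {k : ℕ} (h0 : D.m a b ≠ 0)
    (hk : D.m a b ≤ k) :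
    D.cs.length (D.cs.wordProd (alternatingWord a b k) * D.cs.simple a) < k := by
  obtain ⟨j, rfl⟩ := Nat.exists_eq_add_of_le hk
  obtain ⟨q, hq, e⟩ := D.exists_wordProd_alternatingWord_add a b j (D.m a b)
  have hbraid : D.cs.wordProd (alternatingWord a b (D.m a b)) =
      D.cs.wordProd (alternatingWord b a (D.m a b)) := by
    have := D.cs.wordProd_braidWord_eq a b
    unfold braidWord at this
    rw [D.coxeterMatrix.symmetric b a] at this
    exact this
  obtain ⟨n, hn⟩ := Nat.exists_eq_succ_of_ne_zero h0
  rw [e, hbraid, hn, alternatingWord_succ, CoxeterSystem.wordProd_concat, mul_assoc,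
    mul_assoc, CoxeterSystem.simple_mul_simple_self, mul_one]
  have h1 := D.cs.length_mul_le q (D.cs.wordProd (alternatingWord a b n))
  have h2 := D.cs.length_wordProd_le (alternatingWord a b n)
  rw [length_alternatingWord] at h2
  omega

/-- If right multiplication by `r_a` does not shorten `w`, then `w a` lies in the cone. -/
theorem φ_simpleRoot_mem_cone (w : D.W) (a : D.Δ) (ha : ¬ D.cs.IsRightDescent w a) :
    D.φ w a ∈ D.cone := by
  induction hl : D.cs.length w using Nat.strong_induction_on generalizing w a with
  | _ l ih =>
  subst hl
  by_cases hw : w = 1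
  · subst hw
    simpa using D.simpleRoot_mem_cone a
  obtain ⟨b, hb⟩ := D.cs.exists_rightDescent_of_ne_one hw
  have hab : a ≠ b := by
    rintro rfl
    exact ha hb
  let T : ℕ → Prop := fun k => ∃ u : D.W,
    w = u * D.cs.wordProd (alternatingWord a b k) ∧ D.cs.length u + k = D.cs.length w
  have hT1 : T 1 := by
    refine ⟨w * D.cs.simple b, ?_, D.cs.isRightDescent_iff.1 hb⟩
    rw [show alternatingWord a b 1 = [b] from rfl, CoxeterSystem.wordProd_singleton,
      CoxeterSystem.simple_mul_simple_cancel_right]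
  obtain ⟨k, hk, hTk, hTk'⟩ : ∃ k, 1 ≤ k ∧ T k ∧ ¬ T (k + 1) := by
    by_contra! hall
    have hTall : ∀ k, 1 ≤ k → T k := fun k hk => Nat.le_induction hT1 hall k hk
    obtain ⟨u, -, hu⟩ := hTall (D.cs.length w + 1) (by omega)
    omega
  obtain ⟨u, hwu, hlen⟩ := hTk
  have hfirst : ¬ D.cs.IsRightDescent u (if Even k then b else a) := by
    intro h
    refine hTk' ⟨u * D.cs.simple (if Even k then b else a), ?_, ?_⟩
    · rw [alternatingWord_succ', CoxeterSystem.wordProd_cons, mul_assoc,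
        CoxeterSystem.simple_mul_simple_cancel_left, hwu]
    · have := D.cs.isRightDescent_iff.1 h
      omega
  have hsecond : ¬ D.cs.IsRightDescent u (if Even k then a else b) := by
    intro h
    obtain ⟨j, rfl⟩ : ∃ j, k = j + 1 := ⟨k - 1, by omega⟩
    have e : (if Even (j + 1) then a else b) = if Even j then b else a := by
      by_cases hj : Even j <;> simp [hj, Nat.even_add_one]
    rw [e] at h
    have hlt := D.cs.isRightDescent_iff.1 h
    rw [alternatingWord_succ', CoxeterSystem.wordProd_cons, ← mul_assoc] at hwu
    have h1 := D.cs.length_mul_le (u * D.cs.simple (if Even j then b else a))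
      (D.cs.wordProd (alternatingWord a b j))
    have h2 := D.cs.length_wordProd_le (alternatingWord a b j)
    rw [length_alternatingWord] at h2
    rw [← hwu] at h1
    omega
  have hkm : D.m a b ≠ 0 → k + 1 ≤ D.m a b := by
    intro h0
    by_contra! hlt
    have h1 := D.length_alternatingWord_mul_simple_lt a b h0 (k := k) (by omega)
    have h2 := D.cs.length_mul_le u (D.cs.wordProd (alternatingWord a b k) * D.cs.simple a)
    rw [← mul_assoc, ← hwu] at h2
    have h3 := D.cs.not_isRightDescent_iff.1 ha
    omega
  rw [hwu, φ_mul, φ_alternatingWord_apply, map_add, map_smul, map_smul]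
  exact add_mem
    (PointedCone.smul_mem _ (D.dihedralCoeff_nonneg hab hkm)
      (ih _ (by omega) u _ hsecond rfl))
    (PointedCone.smul_mem _ (D.dihedralCoeff_nonneg hab fun h => (Nat.le_succ k).trans (hkm h))
      (ih _ (by omega) u _ hfirst rfl))

theorem φ_simpleRoot_mem_cone_or_neg_mem_cone (w : D.W) (a : D.Δ) :
    D.φ w a ∈ D.cone ∨ -D.φ w a ∈ D.cone := by
  by_cases h : D.cs.IsRightDescent w a
  · right
    have := D.φ_simpleRoot_mem_cone _ a (D.cs.isRightDescent_iff_not_isRightDescent_mul.1 h)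
    rwa [φ_mul, φ_simple_self, map_neg] at this
  · exact Or.inl (D.φ_simpleRoot_mem_cone w a h)

theorem φ_mem_roots (w : D.W) {x : V} (hx : x ∈ D.roots) : D.φ w x ∈ D.roots := by
  obtain ⟨u, a, rfl⟩ := hx
  exact ⟨w * u, a, (D.φ_mul w u a).symm⟩

theorem form_self_of_mem_roots {x : V} (hx : x ∈ D.roots) : D.form x x = 1 := by
  obtain ⟨u, a, rfl⟩ := hx
  rw [form_φ, D.form_self a a.2]

theorem mem_cone_or_neg_mem_cone {x : V} (hx : x ∈ D.roots) : x ∈ D.cone ∨ -x ∈ D.cone := by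
  obtain ⟨u, a, rfl⟩ := hx
  exact D.φ_simpleRoot_mem_cone_or_neg_mem_cone u a

theorem mem_posRoots_iff {x : V} : x ∈ D.posRoots ↔ x ∈ D.roots ∧ x ∈ D.cone := by
  rw [posRoots, Set.mem_inter_iff, mem_PLC_iff]
  refine ⟨fun h => ⟨h.1, h.2.1⟩, fun h => ⟨h.1, h.2, ?_⟩⟩
  rintro rfl
  simpa using D.form_self_of_mem_roots h.1

theorem simpleRoot_mem_posRoots (a : D.Δ) : (a : V) ∈ D.posRoots :=
  D.mem_posRoots_iff.2 ⟨⟨1, a, by simp⟩, D.simpleRoot_mem_cone a⟩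

/-- Every element of the cone is `t a + y`, with `t ≥ 0` and `y` in the cone spanned by the other
elements of the root basis. -/
theorem exists_eq_smul_add (a : D.Δ) {x : V} (hx : x ∈ D.cone) :
    ∃ t : ℝ, 0 ≤ t ∧ ∃ y ∈ PointedCone.hull ℝ (D.Δ \ {(a : V)}), x = t • (a : V) + y := by
  have hins : D.Δ = insert (a : V) (D.Δ \ {(a : V)}) := by
    rw [Set.insert_sdiff_singleton, Set.insert_eq_of_mem a.2]
  rw [cone, hins, PointedCone.hull, Submodule.mem_span_insert] at hx
  obtain ⟨t, y, hy, rfl⟩ := hx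
  exact ⟨t, t.2, y, by simpa using hy, rfl⟩

theorem form_nonpos_of_mem_hull_diff (a : D.Δ) {y : V}
    (hy : y ∈ PointedCone.hull ℝ (D.Δ \ {(a : V)})) : D.form a y ≤ 0 := by
  have := nonneg_of_mem_hull (-(D.form a)) (fun b hb => ?_) hy
  · simpa using this
  · rw [LinearMap.neg_apply, neg_nonneg]
    rcases D.form_ne a a.2 b hb.1 (fun h => hb.2 h.symm) with ⟨m, hm, h⟩ | h
    · rw [h, neg_nonpos]
      have hm' : (2 : ℝ) ≤ m := by exact_mod_cast hm
      have hpi := Real.pi_pos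
      refine Real.cos_nonneg_of_mem_Icc ⟨?_, ?_⟩
      · have : 0 ≤ Real.pi / m := by positivity
        linarith
      · exact div_le_div_of_nonneg_left hpi.le (by norm_num) hm'
    · linarith

/-- The reflection in `a ∈ Δ` permutes the positive roots other than `a`. -/
theorem φ_simple_mem_posRoots (a : D.Δ) {x : V} (hx : x ∈ D.posRoots) (hxa : x ≠ a) :
    D.φ (D.cs.simple a) x ∈ D.posRoots := by
  obtain ⟨hr, hc⟩ := D.mem_posRoots_iff.1 hx
  have hr' := D.φ_mem_roots (D.cs.simple a) hr
  refine D.mem_posRoots_iff.2 ⟨hr', (D.mem_cone_or_neg_mem_cone hr').resolve_right fun hneg => ?_⟩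
  obtain ⟨t, ht, y, hy, hxy⟩ := D.exists_eq_smul_add a hc
  obtain ⟨t', ht', y', hy', hxy'⟩ := D.exists_eq_smul_add a hneg
  have hle : PointedCone.hull ℝ (D.Δ \ {(a : V)}) ≤ D.cone := Submodule.span_mono Set.sdiff_subset
  rw [φ_cs_simple] at hxy'
  set s : ℝ := 2 * D.form x a - (t + t') with hs
  have hsum : s • (a : V) = y + y' := by
    have : y + y' = (x - t • (a : V)) + (-(x - (2 * D.form x a) • (a : V)) - t' • (a : V)) := by
      rw [hxy', hxy]
      abel
    rw [this, hs]
    module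
  have hs0 : s ≤ 0 := by
    have := D.form_nonpos_of_mem_hull_diff a (add_mem hy hy')
    rwa [← hsum, map_smul, D.form_self a a.2, smul_eq_mul, mul_one] at this
  have hy0 : y = 0 := by
    refine D.eq_zero_of_add_eq_zero_of_mem_cone (hle hy)
      (add_mem (hle hy') (PointedCone.smul_mem _ (neg_nonneg.2 hs0) (D.simpleRoot_mem_cone a))) ?_
    rw [← add_assoc, ← hsum]
    module
  rw [hy0, add_zero] at hxy
  have h1 := D.form_self_of_mem_roots hr
  rw [hxy] at h1
  simp only [map_smul, LinearMap.smul_apply, smul_eq_mul, D.form_self a a.2, mul_one] at h1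
  have ht1 : t = 1 := by nlinarith
  exact hxa (by rw [hxy, ht1, one_smul])

theorem finite_posRoots_φ_notMem (w : D.W) :
    {x ∈ D.posRoots | D.φ w x ∉ D.posRoots}.Finite := by
  induction w using D.cs.simple_induction_right with
  | one =>
    convert Set.finite_empty
    ext x
    simp
  | mul_simple_right w a ih =>
    refine ((ih.image (D.φ (D.cs.simple a))).union (Set.finite_singleton (a : V))).subset ?_
    rintro x ⟨hx, hwx⟩
    by_cases hxa : x = a
    · exact Or.inr hxa
    · rw [φ_mul] at hwx
      exact Or.inl ⟨_, ⟨D.φ_simple_mem_posRoots a hx hxa, hwx⟩, D.φ_simple_simple a x⟩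

theorem φ_mem_cone_of_antidominant {v : V} (hv : v ∈ D.cone)
    (hneg : ∀ a ∈ D.posRoots, D.form v a ≤ 0) (w : D.W) : D.φ w v ∈ D.cone := by
  induction hl : D.cs.length w generalizing w with
  | zero =>
    rw [D.cs.length_eq_zero_iff] at hl
    simpa [hl] using hv
  | succ n ih =>
    have hw : w ≠ 1 := by
      rintro rfl
      simp at hl
    obtain ⟨a, ha⟩ := D.cs.exists_rightDescent_of_ne_one hw
    have hlen := D.cs.isRightDescent_iff.1 ha
    have hroot := D.φ_simpleRoot_mem_cone _ a
      (D.cs.isRightDescent_iff_not_isRightDescent_mul.1 ha)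
    have e : D.φ w v = D.φ (w * D.cs.simple a) v +
        (-(2 * D.form v a)) • D.φ (w * D.cs.simple a) a := by
      rw [φ_mul, φ_mul, φ_cs_simple, φ_simple_self]
      simp only [map_sub, map_smul, map_neg]
      module
    rw [e]
    have := hneg a (D.simpleRoot_mem_posRoots a)
    exact add_mem (ih _ (by omega)) (PointedCone.smul_mem _ (by linarith) hroot)

theorem mem_dualTitsCone_iff {v : V} :
    v ∈ D.dualTitsCone ↔ ∀ w : D.W, ∀ f ∈ D.dualP, 0 ≤ f (D.φ w v) := by
  refine ⟨fun h w f hf => ?_, fun h g hg => ?_⟩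
  · simpa [dualAct] using h (D.dualAct w⁻¹ f) (Set.mem_iUnion.2 ⟨w⁻¹, f, hf, rfl⟩)
  · obtain ⟨w, f, hf, rfl⟩ := Set.mem_iUnion.1 hg
    exact h w⁻¹ f hf

theorem φ_mem_dualTitsCone (w : D.W) {v : V} (hv : v ∈ D.dualTitsCone) :
    D.φ w v ∈ D.dualTitsCone := by
  rw [mem_dualTitsCone_iff] at hv ⊢
  intro u f hf
  rw [← φ_mul]
  exact hv _ f hf

theorem mem_cone_of_mem_dualTitsCone (hΔ : D.Δ.Finite) {v : V} (hv : v ∈ D.dualTitsCone) :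
    v ∈ D.cone := by
  by_contra h
  obtain ⟨f, hf, hfv⟩ := exists_dual_neg_of_notMem_hull hΔ.toFinset id v (by simpa [cone] using h)
  have := D.mem_dualTitsCone_iff.1 hv 1 f fun x hx =>
    nonneg_of_mem_hull f (fun a ha => hf a (by simpa using ha)) (D.mem_P_iff.1 hx)
  rw [map_one] at this
  exact absurd this (not_le.2 hfv)

theorem φ_mem_imaginaryCone {v : V} (hv : v ∈ D.cone)
    (hneg : ∀ a ∈ D.posRoots, D.form v a ≤ 0) (w : D.W) : D.φ w v ∈ D.imaginaryCone := by
  refine ⟨D.mem_dualTitsCone_iff.2 fun u f hf => ?_, (D.finite_posRoots_φ_notMem w⁻¹).subset ?_⟩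
  · rw [← φ_mul]
    exact hf _ (D.mem_P_iff.2 (D.φ_mem_cone_of_antidominant hv hneg _))
  · rintro x ⟨hx, hpos⟩
    refine ⟨hx, fun h => hpos ?_⟩
    rw [form_φ_left]
    exact hneg _ h

theorem exists_simpleRoot_form_pos {v x : V} (hx : x ∈ D.cone) (hpos : 0 < D.form v x) :
    ∃ a : D.Δ, 0 < D.form v a := by
  by_contra! h
  have := nonneg_of_mem_hull (-(D.form v)) (fun b hb => by simpa using h ⟨b, hb⟩) hx
  rw [LinearMap.neg_apply] at this
  linarith

theorem exists_antidominant_of_mem_imaginaryCone (hΔ : D.Δ.Finite) {v : V}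
    (hv : v ∈ D.imaginaryCone) :
    ∃ w : D.W, D.φ w v ∈ D.cone ∧ ∀ a ∈ D.posRoots, D.form (D.φ w v) a ≤ 0 := by
  obtain ⟨hU, hfin⟩ := hv
  induction hn : {a ∈ D.posRoots | ¬ D.form v a ≤ 0}.ncard using Nat.strong_induction_on
    generalizing v with
  | _ n ih =>
  by_cases hneg : ∀ a ∈ D.posRoots, D.form v a ≤ 0
  · exact ⟨1, by simpa using D.mem_cone_of_mem_dualTitsCone hΔ hU, by simpa using hneg⟩
  push Not at hneg
  obtain ⟨x, hx, hpos⟩ := hneg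
  obtain ⟨a, ha⟩ := D.exists_simpleRoot_form_pos (D.mem_posRoots_iff.1 hx).2 hpos
  set S := {a ∈ D.posRoots | ¬ D.form v a ≤ 0} with hS
  have haS : (a : V) ∈ S := ⟨D.simpleRoot_mem_posRoots a, not_le.2 ha⟩
  have hsub : {b ∈ D.posRoots | ¬ D.form (D.φ (D.cs.simple a) v) b ≤ 0} ⊆
      D.φ (D.cs.simple a) '' (S \ {(a : V)}) := by
    rintro b ⟨hb, hbpos⟩
    rw [form_φ_left, CoxeterSystem.inv_simple] at hbpos
    have hba : b ≠ a := by
      rintro rfl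
      apply hbpos
      rw [φ_simple_self, map_neg]
      linarith
    refine ⟨_, ⟨⟨D.φ_simple_mem_posRoots a hb hba, hbpos⟩, fun h => ?_⟩, D.φ_simple_simple a b⟩
    have h' : b = -(a : V) := by
      rw [← D.φ_simple_simple a b, Set.mem_singleton_iff.1 h, φ_simple_self]
    have h0 := D.eq_zero_of_add_eq_zero_of_mem_cone (D.mem_posRoots_iff.1 hb).2
      (D.simpleRoot_mem_cone a) (by rw [h', neg_add_cancel])
    simpa [h0] using D.form_self_of_mem_roots hb.1
  have hfinS : (S \ {(a : V)}).Finite := hfin.sdiff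
  obtain ⟨w, hw, hw'⟩ := ih _ (lt_of_le_of_lt (Set.ncard_le_ncard hsub (hfinS.image _))
    (lt_of_le_of_lt (Set.ncard_image_le hfinS)
      (hn ▸ Set.ncard_sdiff_singleton_lt_of_mem haS hfin)))
    (D.φ_mem_dualTitsCone _ hU) ((hfinS.image _).subset hsub) rfl
  exact ⟨w * D.cs.simple a, by rwa [φ_mul], by rwa [φ_mul]⟩

end CoxeterDatum

theorem mainTheorem9 {V : Type*} [AddCommGroup V] [Module ℝ V] (D : CoxeterDatum V)
    (hΔ : D.Δ.Finite) :
    D.imaginaryCone =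
      {x : V | ∃ (w : D.W) (v : V), v ∈ D.P ∧ (∀ a ∈ D.posRoots, D.form v a ≤ 0) ∧
        x = D.φ w v} := by
  ext x
  constructor
  · intro hx
    obtain ⟨w, hw, hw'⟩ := D.exists_antidominant_of_mem_imaginaryCone hΔ hx
    exact ⟨w⁻¹, D.φ w x, D.mem_P_iff.2 hw, hw', (D.φ_inv_apply w x).symm⟩
  · rintro ⟨w, v, hv, hneg, rfl⟩
    exact D.φ_mem_imaginaryCone (D.mem_P_iff.1 hv) hneg w
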